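/- Let $q \in [2,\infty)$, let $(\mathcal X,\mathcal A,\mu)$ be a measure space, and let $\mathbb L^q=\mathbb L^q(\mathcal X,\mathcal A,\mu)$ be the space of real-valued $q$-integrable functions with its norm $|\cdot|_q$. On a probability space $(\Omega,\mathcal F,\mathbb P)$ let $(d_i)_{i\ge1}$ be a sequence of $\mathbb L^q$-valued martingale differences with respect to a filtration $(\mathcal F_i)$, that is, each $d_i$ is (strongly) $\mathcal F_i$-measurable and Bochner integrable, and $\mathbb E(d_{i+1}\mid\mathcal F_i)=0$ almost surely for all $i\ge1$. Assume that there is a real $b>0$ such that $\Vert\,|d_i|_q\,\Vert_\infty\le b$ for all $i\ge1$, and put $M_k=\sum_{i=1}^k d_i$. Then for every integer $n\ge1$ and every real $x>0$, $$\mathbb P\Big(\max_{1\le k\le n}|M_k|_q\ge x\Big)\le B_q(b,n,x):=\begin{cases}1 & \text{if } x<b\sqrt{(q-1)n},\\[2pt] \dfrac{(b^2(q-1)n)^{q/2}}{x^q} & \text{if } b\sqrt{(q-1)n}\le x<b\sqrt{e(q-1)n},\\[6pt] \dfrac1{\sqrt e}\exp\Big(-\dfrac{x^2}{2eb^2n}\Big)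 & \text{if } x\ge b\sqrt{e(q-1)n}.\end{cases}$$ Moreover, if $q\ge e+1$, then this bound is always better than the bound of Pinelis: for every integer $n\ge1$ and every real $x>0$, $$B_q(b,n,x)<2\exp\Big(-\frac{x^2}{2(q-1)b^2n}\Big).$$ -/

import Mathlib

open MeasureTheory

/-- The exponent `q ∈ [2, ∞)` makes `Lp ℝ q μ` a Banach space. -/
instance fact_one_le_ofReal (q : ℝ) [hq : Fact (2 ≤ q)] :
    Fact ((1 : ENNReal) ≤ ENNReal.ofReal q) :=
  ⟨by
    rw [← ENNReal.ofReal_one]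
    exact ENNReal.ofReal_le_ofReal (one_le_two.trans hq.out)⟩

/-- `(d i)`, `i ≥ 1`, is a sequence of martingale differences with values in the Banach space `E`
with respect to the filtration `(ℱ i)`: each `d i` is `ℱ i`-measurable and (Bochner) integrable,
and `𝔼[d (i + 1) | ℱ i] = 0` almost surely. The index `0` plays no role. -/
structure IsMartingaleDifference {Ω E : Type*} {mΩ : MeasurableSpace Ω}
    [NormedAddCommGroup E] [NormedSpace ℝ E] [CompleteSpace E]
    (d : ℕ → Ω → E) (ℱ : Filtration ℕ mΩ) (P : Measure Ω) : Prop where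
  stronglyMeasurable : ∀ i, 1 ≤ i → StronglyMeasurable[ℱ i] (d i)
  integrable : ∀ i, 1 ≤ i → Integrable (d i) P
  condExp_eq_zero : ∀ i, 1 ≤ i → P[d (i + 1) | ℱ i] =ᵐ[P] 0

/-- The partial sum `M k = d 1 + ⋯ + d k`. -/
def partialSum {Ω E : Type*} [AddCommMonoid E] (d : ℕ → Ω → E) (k : ℕ) (ω : Ω) : E :=
  ∑ i ∈ Finset.Icc 1 k, d i ω

/-- The three-regime deviation bound. -/
noncomputable def threeRegimeBound (q b : ℝ) (n : ℕ) (x : ℝ) : ℝ :=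
  if x < b * √((q - 1) * n) then 1
  else if x < b * √(Real.exp 1 * (q - 1) * n) then (b ^ 2 * (q - 1) * n) ^ (q / 2) / x ^ q
  else 1 / √(Real.exp 1) * Real.exp (-(x ^ 2 / (2 * Real.exp 1 * b ^ 2 * n)))

/-- Pinelis' deviation bound. -/
noncomputable def pinelisBound (q b : ℝ) (n : ℕ) (x : ℝ) : ℝ :=
  2 * Real.exp (-(x ^ 2 / (2 * (q - 1) * b ^ 2 * n)))

/-! The key is a moment bound valid for every `p ≥ q`, not only for `p = q`: the `p`-th moment of
`‖M_n‖` is at most `(b² (p - 1) n) ^ (p / 2)`. Doob's maximal inequality then bounds the probability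
by this quantity over `x ^ p`. The middle regime takes `p = q`; the last takes `p = 1 + x² / (e b²
n)`, which is at least `q` exactly when `x ≥ b √(e (q - 1) n)`.

The moment bound comes from smoothness. A two-point inequality with constant `p - 1` holds on the
real line (`add_rpow_add_sub_rpow_le`) and passes to `L^q` for `2 ≤ q ≤ p`
(`TwoPointSmooth.lpSpace`). Passing once more, with exponent `p`, it holds in `L^p(Ω; L^q)`, which
is therefore 2-smooth with constant `p - 1`. Conditional expectation contracts `L^p`, so a
martingale is Birkhoff orthogonal to its next increment, and each increment adds at most `(p - 1)
b²` to the squared `L^p` norm (`sq_eLpNorm_add_le`). -/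

/-! ### The two-point inequality on the real line -/

theorem sq_rpow_half {a : ℝ} (ha : 0 ≤ a) (p : ℝ) : (a ^ 2) ^ (p / 2) = a ^ p := by
  rw [← Real.rpow_natCast, ← Real.rpow_mul ha]; congr 1; push_cast; ring

/-- Concavity of `x ↦ x ^ ((p - 2) / p)` applied to the two points `(1 + t) ^ p`, `(1 - t) ^ p`. -/
theorem rpow_sub_two_mean_le {p t : ℝ} (hp : 2 ≤ p) (h0 : 0 ≤ t) (h1 : t ≤ 1) :
    ((1 + t) ^ (p - 2) + (1 - t) ^ (p - 2)) / 2 ≤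
      (((1 + t) ^ p + (1 - t) ^ p) / 2) ^ (1 - 2 / p) := by
  have hp0 : 0 < p := by linarith
  have hθ0 : 0 ≤ 1 - 2 / p := by
    rw [sub_nonneg, div_le_one hp0]; exact hp
  have hθ1 : 1 - 2 / p ≤ 1 := by
    have : 0 < 2 / p := by positivity
    linarith
  have hmul : p * (1 - 2 / p) = p - 2 := by field_simp
  have key := (Real.concaveOn_rpow hθ0 hθ1).2
    (Set.mem_Ici.2 (by positivity : 0 ≤ (1 + t) ^ p))
    (Set.mem_Ici.2 (Real.rpow_nonneg (by linarith) _ : 0 ≤ (1 - t) ^ p))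
    (by norm_num : (0 : ℝ) ≤ 1 / 2) (by norm_num : (0 : ℝ) ≤ 1 / 2) (by norm_num)
  simp only [smul_eq_mul] at key
  rw [← Real.rpow_mul (by linarith), ← Real.rpow_mul (by linarith), hmul] at key
  calc _ = 1 / 2 * (1 + t) ^ (p - 2) + 1 / 2 * (1 - t) ^ (p - 2) := by ring
    _ ≤ _ := key
    _ = _ := by congr 1; ring

theorem hasDerivAt_one_add_rpow {r t : ℝ} (ht : 0 < 1 + t) :
    HasDerivAt (fun t : ℝ => (1 + t) ^ r) (r * (1 + t) ^ (r - 1)) t := by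
  have := ((hasDerivAt_id t).const_add 1).rpow_const (p := r) (Or.inl ht.ne')
  simpa using this

theorem hasDerivAt_one_sub_rpow {r t : ℝ} (ht : 0 < 1 - t) :
    HasDerivAt (fun t : ℝ => (1 - t) ^ r) (-(r * (1 - t) ^ (r - 1))) t := by
  have := ((hasDerivAt_id t).const_sub 1).rpow_const (p := r) (Or.inl ht.ne')
  simpa using this

theorem hasDerivAt_mean_rpow {p t : ℝ} (h0 : 0 < t) (h1 : t < 1) :
    HasDerivAt (fun t : ℝ => ((1 + t) ^ p + (1 - t) ^ p) / 2)
      (p * (((1 + t) ^ (p - 1) - (1 - t) ^ (p - 1)) / 2)) t := by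
  have := ((hasDerivAt_one_add_rpow (r := p) (t := t) (by linarith)).add
    (hasDerivAt_one_sub_rpow (r := p) (t := t) (by linarith))).div_const 2
  refine this.congr_deriv ?_
  ring

theorem mean_rpow_pos {p t : ℝ} (h0 : 0 ≤ t) (h1 : t ≤ 1) :
    0 < ((1 + t) ^ p + (1 - t) ^ p) / 2 := by
  have h2 : 0 < (1 + t) ^ p := Real.rpow_pos_of_pos (by linarith) _
  have h3 : 0 ≤ (1 - t) ^ p := Real.rpow_nonneg (by linarith) _
  linarith

theorem continuous_one_add_rpow {r : ℝ} (hr : 0 ≤ r) : Continuous fun t : ℝ => (1 + t) ^ r :=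
  (continuous_const.add continuous_id).rpow_const fun _ => Or.inr hr

theorem continuous_one_sub_rpow {r : ℝ} (hr : 0 ≤ r) : Continuous fun t : ℝ => (1 - t) ^ r :=
  (continuous_const.sub continuous_id).rpow_const fun _ => Or.inr hr

/-- Both sides vanish at `t = 0`, so derivatives are compared. The left one is `p - 1` times the
mean of `(1 ± t) ^ (p - 2)`, which `rpow_sub_two_mean_le` bounds by one term of the product rule on
the right; the other term is nonnegative. -/
theorem half_rpow_sub_le {p t : ℝ} (hp : 2 ≤ p) (h0 : 0 ≤ t) (h1 : t ≤ 1) :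
    ((1 + t) ^ (p - 1) - (1 - t) ^ (p - 1)) / 2 ≤
      (p - 1) * t * (((1 + t) ^ p + (1 - t) ^ p) / 2) ^ (1 - 2 / p) := by
  have hp0 : 0 < p := by linarith
  have hθ0 : 0 ≤ 1 - 2 / p := by
    rw [sub_nonneg, div_le_one hp0]; exact hp
  let H : ℝ → ℝ := fun t => (p - 1) * t * (((1 + t) ^ p + (1 - t) ^ p) / 2) ^ (1 - 2 / p) -
    ((1 + t) ^ (p - 1) - (1 - t) ^ (p - 1)) / 2
  have hcont : Continuous H :=
    ((continuous_const.mul continuous_id).mul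
      ((((continuous_one_add_rpow hp0.le).add
        (continuous_one_sub_rpow hp0.le)).div_const 2).rpow_const fun _ => Or.inr hθ0)).sub
      (((continuous_one_add_rpow (by linarith)).sub
        (continuous_one_sub_rpow (by linarith))).div_const 2)
  have hder : ∀ t ∈ Set.Ioo (0 : ℝ) 1, ∃ D, HasDerivAt H D t ∧ 0 ≤ D := by
    rintro t ⟨h0, h1⟩
    have hg := mean_rpow_pos (p := p) h0.le h1.le
    have hG := (hasDerivAt_mean_rpow (p := p) h0 h1).rpow_const (p := 1 - 2 / p) (Or.inl hg.ne')
    have hh := ((hasDerivAt_one_add_rpow (r := p - 1) (t := t) (by linarith)).sub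
      (hasDerivAt_one_sub_rpow (r := p - 1) (t := t) (by linarith))).div_const 2
    refine ⟨_, ((((hasDerivAt_id t).const_mul (p - 1))).mul hG).sub hh, ?_⟩
    have hm := rpow_sub_two_mean_le hp h0.le h1.le
    have hle : (1 - t) ^ (p - 1) ≤ (1 + t) ^ (p - 1) :=
      Real.rpow_le_rpow (by linarith) (by linarith) (by linarith)
    have e : p - 1 - 1 = p - 2 := by ring
    rw [e]
    have hpos : 0 ≤ (p - 1) * t * (p * (((1 + t) ^ (p - 1) - (1 - t) ^ (p - 1)) / 2) * (1 - 2 / p) *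
        (((1 + t) ^ p + (1 - t) ^ p) / 2) ^ (1 - 2 / p - 1)) := by
      have : 0 ≤ (1 + t) ^ (p - 1) - (1 - t) ^ (p - 1) := by linarith
      have : 0 ≤ p - 1 := by linarith
      positivity
    have hm' := mul_le_mul_of_nonneg_left hm (show 0 ≤ p - 1 by linarith)
    simp only [id]
    linarith
  have hmono : MonotoneOn H (Set.Icc 0 1) := by
    refine monotoneOn_of_deriv_nonneg (convex_Icc 0 1) hcont.continuousOn ?_ ?_
    · rw [interior_Icc]
      intro t ht
      obtain ⟨D, hD, -⟩ := hder t ht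
      exact hD.differentiableAt.differentiableWithinAt
    · rw [interior_Icc]
      intro t ht
      obtain ⟨D, hD, hD0⟩ := hder t ht
      rwa [hD.deriv]
  have := hmono (Set.left_mem_Icc.2 zero_le_one) ⟨h0, h1⟩ h0
  simp only [H] at this
  norm_num at this
  linarith

/-- Equality holds at `t = 0`, and the comparison of derivatives is `half_rpow_sub_le` multiplied by
the power `2 / p - 1` of the mean. -/
theorem mean_rpow_rpow_le {p t : ℝ} (hp : 2 ≤ p) (h0 : 0 ≤ t) (h1 : t ≤ 1) :
    (((1 + t) ^ p + (1 - t) ^ p) / 2) ^ (2 / p) ≤ 1 + (p - 1) * t ^ 2 := by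
  have hp0 : 0 < p := by linarith
  let K : ℝ → ℝ := fun t => 1 + (p - 1) * t ^ 2 - (((1 + t) ^ p + (1 - t) ^ p) / 2) ^ (2 / p)
  have hcont : Continuous K :=
    (by fun_prop : Continuous fun t : ℝ => 1 + (p - 1) * t ^ 2).sub
      ((((continuous_one_add_rpow hp0.le).add
        (continuous_one_sub_rpow hp0.le)).div_const 2).rpow_const fun _ => Or.inr (by positivity))
  have hder : ∀ t ∈ Set.Ioo (0 : ℝ) 1, ∃ D, HasDerivAt K D t ∧ 0 ≤ D := by
    rintro t ⟨h0, h1⟩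
    have hg := mean_rpow_pos (p := p) h0.le h1.le
    have hG := (hasDerivAt_mean_rpow (p := p) h0 h1).rpow_const (p := 2 / p) (Or.inl hg.ne')
    refine ⟨_, ((((hasDerivAt_pow 2 t).const_mul (p - 1))).const_add 1).sub hG, ?_⟩
    have hm := half_rpow_sub_le hp h0.le h1.le
    set g := ((1 + t) ^ p + (1 - t) ^ p) / 2
    have hmul : g ^ (1 - 2 / p) * g ^ (2 / p - 1) = 1 := by
      rw [← Real.rpow_add hg]; simp
    have hm' := mul_le_mul_of_nonneg_right hm (Real.rpow_nonneg hg.le (2 / p - 1))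
    rw [mul_assoc, hmul, mul_one] at hm'
    have e : p * (((1 + t) ^ (p - 1) - (1 - t) ^ (p - 1)) / 2) * (2 / p) * g ^ (2 / p - 1) =
        2 * (((1 + t) ^ (p - 1) - (1 - t) ^ (p - 1)) / 2 * g ^ (2 / p - 1)) := by
      field_simp
    rw [e]
    norm_num
    linarith
  have hmono : MonotoneOn K (Set.Icc 0 1) := by
    refine monotoneOn_of_deriv_nonneg (convex_Icc 0 1) hcont.continuousOn ?_ ?_
    · rw [interior_Icc]
      intro t ht
      obtain ⟨D, hD, -⟩ := hder t ht
      exact hD.differentiableAt.differentiableWithinAt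
    · rw [interior_Icc]
      intro t ht
      obtain ⟨D, hD, hD0⟩ := hder t ht
      rwa [hD.deriv]
  have := hmono (Set.left_mem_Icc.2 zero_le_one) ⟨h0, h1⟩ h0
  simp only [K] at this
  norm_num at this
  linarith

theorem add_rpow_add_sub_rpow_le {p a b : ℝ} (hp : 2 ≤ p) (hb : 0 ≤ b) (hba : b ≤ a) :
    (a + b) ^ p + (a - b) ^ p ≤ 2 * (a ^ 2 + (p - 1) * b ^ 2) ^ (p / 2) := by
  have hp0 : 0 < p := by linarith
  rcases (hb.trans hba).eq_or_lt with ha | ha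
  · obtain rfl : b = 0 := le_antisymm (ha ▸ hba) hb
    simp [← ha, Real.zero_rpow hp0.ne']
    positivity
  set t := b / a with ht
  have h0 : 0 ≤ t := by positivity
  have h1 : t ≤ 1 := (div_le_one ha).2 hba
  have hb' : b = a * t := by rw [ht]; field_simp
  have key := Real.rpow_le_rpow (Real.rpow_nonneg (mean_rpow_pos h0 h1).le _)
    (mean_rpow_rpow_le hp h0 h1) (show 0 ≤ p / 2 by positivity)
  rw [← Real.rpow_mul (mean_rpow_pos h0 h1).le, show 2 / p * (p / 2) = 1 by field_simp,
    Real.rpow_one] at key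
  have e1 : a + b = a * (1 + t) := by rw [hb']; ring
  have e2 : a - b = a * (1 - t) := by rw [hb']; ring
  have e3 : a ^ 2 + (p - 1) * b ^ 2 = a ^ 2 * (1 + (p - 1) * t ^ 2) := by rw [hb']; ring
  have h3 : 0 ≤ 1 + (p - 1) * t ^ 2 := by
    have : 0 ≤ p - 1 := by linarith
    positivity
  rw [e1, e2, e3, Real.mul_rpow ha.le (by linarith), Real.mul_rpow ha.le (by linarith),
    Real.mul_rpow (by positivity) h3, sq_rpow_half ha.le]
  have := mul_le_mul_of_nonneg_left key (Real.rpow_nonneg ha.le p)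
  linarith

/-! ### The two-point inequality in `L^q` spaces -/

/-- A quantitative form of 2-uniform smoothness with constant `p - 1`: the `L^p` mean of
`‖x ± y‖` is at most `(‖x‖² + (p - 1) ‖y‖²) ^ (1 / 2)`. -/
def TwoPointSmooth (p : ℝ) (E : Type*) [NormedAddCommGroup E] : Prop :=
  ∀ x y : E, ‖x + y‖ ^ p + ‖x - y‖ ^ p ≤ 2 * (‖x‖ ^ 2 + (p - 1) * ‖y‖ ^ 2) ^ (p / 2)

theorem twoPointSmooth_real {p : ℝ} (hp : 2 ≤ p) : TwoPointSmooth p ℝ := by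
  have hnonneg : ∀ a b : ℝ, 0 ≤ a → 0 ≤ b →
      |a + b| ^ p + |a - b| ^ p ≤ 2 * (|a| ^ 2 + (p - 1) * |b| ^ 2) ^ (p / 2) := by
    intro a b ha hb
    rw [abs_of_nonneg ha, abs_of_nonneg hb, abs_of_nonneg (add_nonneg ha hb)]
    rcases le_total b a with h | h
    · rw [abs_of_nonneg (sub_nonneg.2 h)]
      exact add_rpow_add_sub_rpow_le hp hb h
    · rw [abs_of_nonpos (sub_nonpos.2 h), neg_sub, add_comm a b]
      refine (add_rpow_add_sub_rpow_le hp ha h).trans ?_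
      -- Since `p - 1 ≥ 1`, exchanging `a` and `b` moves the larger weight onto the larger number.
      have h2 : a ^ 2 ≤ b ^ 2 := pow_le_pow_left₀ ha h 2
      have h3 : 0 ≤ p - 1 := by linarith
      gcongr 2 * ?_ ^ (p / 2)
      nlinarith
  intro x y
  simp only [Real.norm_eq_abs]
  rcases le_total 0 x with hx | hx <;> rcases le_total 0 y with hy | hy
  · exact hnonneg x y hx hy
  · have := hnonneg x (-y) hx (by linarith)
    rw [abs_neg, sub_neg_eq_add, ← sub_eq_add_neg] at this
    linarith
  · have := hnonneg (-x) y (by linarith) hy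
    rw [abs_neg, show -x + y = -(x - y) by ring, show -x - y = -(x + y) by ring, abs_neg,
      abs_neg] at this
    linarith
  · have := hnonneg (-x) (-y) (by linarith) (by linarith)
    rw [abs_neg, abs_neg, show -x + -y = -(x + y) by ring, show -x - -y = -(x - y) by ring, abs_neg,
      abs_neg] at this
    linarith

/-- Minkowski's inequality for nonnegative functions, in terms of Bochner integrals. -/
theorem integral_add_rpow_le {α : Type*} {mα : MeasurableSpace α} {μ : Measure α}
    {f g : α → ℝ} {s : ℝ} (hs : 1 ≤ s) (hf0 : ∀ x, 0 ≤ f x) (hg0 : ∀ x, 0 ≤ g x)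
    (hfm : AEStronglyMeasurable f μ) (hgm : AEStronglyMeasurable g μ)
    (hf : Integrable (fun x => f x ^ s) μ) (hg : Integrable (fun x => g x ^ s) μ) :
    Integrable (fun x => (f x + g x) ^ s) μ ∧
    ∫ x, (f x + g x) ^ s ∂μ ≤ ((∫ x, f x ^ s ∂μ) ^ s⁻¹ + (∫ x, g x ^ s ∂μ) ^ s⁻¹) ^ s := by
  have hs0 : 0 < s := by linarith
  have hne : ENNReal.ofReal s ≠ 0 := by simpa using hs0
  have htr : (ENNReal.ofReal s).toReal = s := ENNReal.toReal_ofReal hs0.le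
  have hmem : ∀ {h : α → ℝ}, (∀ x, 0 ≤ h x) → AEStronglyMeasurable h μ →
      (Integrable (fun x => h x ^ s) μ ↔ MemLp h (ENNReal.ofReal s) μ) := by
    intro h h0 hm
    rw [← integrable_norm_rpow_iff hm hne ENNReal.ofReal_ne_top, htr]
    simp only [Real.norm_of_nonneg (h0 _)]
  have hlp : ∀ {h : α → ℝ}, (∀ x, 0 ≤ h x) → AEStronglyMeasurable h μ →
      lpNorm h (ENNReal.ofReal s) μ = (∫ x, h x ^ s ∂μ) ^ s⁻¹ := by
    intro h h0 hm
    rw [lpNorm_eq_integral_norm_rpow_toReal hne ENNReal.ofReal_ne_top hm, htr]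
    simp only [Real.norm_of_nonneg (h0 _)]
  have hf' := (hmem hf0 hfm).1 hf
  have hg' := (hmem hg0 hgm).1 hg
  have hadd0 : ∀ x, 0 ≤ (f + g) x := fun x => add_nonneg (hf0 x) (hg0 x)
  refine ⟨(hmem hadd0 (hfm.add hgm)).2 (hf'.add hg'), ?_⟩
  have key := lpNorm_add_le (g := g) hf' (by simpa using ENNReal.ofReal_le_ofReal hs)
  rw [hlp hadd0 (hfm.add hgm), hlp hf0 hfm, hlp hg0 hgm] at key
  have hI : 0 ≤ ∫ x, (f + g) x ^ s ∂μ := integral_nonneg fun x => Real.rpow_nonneg (hadd0 x) s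
  have := Real.rpow_le_rpow (Real.rpow_nonneg hI _) key hs0.le
  rwa [← Real.rpow_mul hI, inv_mul_cancel₀ hs0.ne', Real.rpow_one] at this

/-- The triangle inequality for the integral of a function with values in `ℝ²` with the
`ℓ^r` norm. -/
theorem integral_rpow_add_integral_rpow_le {α : Type*} {mα : MeasurableSpace α} {μ : Measure α}
    {f g : α → ℝ} {r : ℝ} (hr : 1 ≤ r) (hf0 : ∀ x, 0 ≤ f x) (hg0 : ∀ x, 0 ≤ g x)
    (hf : Integrable f μ) (hg : Integrable g μ) :
    ((∫ x, f x ∂μ) ^ r + (∫ x, g x ∂μ) ^ r) ^ (1 / r) ≤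
      ∫ x, (f x ^ r + g x ^ r) ^ (1 / r) ∂μ := by
  have hr0 : 0 < r := by linarith
  have htr : (ENNReal.ofReal r).toReal = r := ENNReal.toReal_ofReal hr0.le
  have : Fact (1 ≤ ENNReal.ofReal r) := ⟨by simpa using ENNReal.ofReal_le_ofReal hr⟩
  let e := (WithLp.prodContinuousLinearEquiv (ENNReal.ofReal r) ℝ ℝ ℝ).symm
  have hnorm : ∀ x y : ℝ, 0 ≤ x → 0 ≤ y → ‖e (x, y)‖ = (x ^ r + y ^ r) ^ (1 / r) := by
    intro x y hx hy
    rw [WithLp.prod_norm_eq_add (by rw [htr]; exact hr0), htr]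
    simp [e, abs_of_nonneg hx, abs_of_nonneg hy]
  have hint : ∫ x, e (f x, g x) ∂μ = e (∫ x, f x ∂μ, ∫ x, g x ∂μ) := by
    rw [← integral_pair hf hg]
    exact e.integral_comp_comm _
  calc _ = ‖∫ x, e (f x, g x) ∂μ‖ := by
        rw [hint, hnorm _ _ (integral_nonneg hf0) (integral_nonneg hg0)]
    _ ≤ ∫ x, ‖e (f x, g x)‖ ∂μ := norm_integral_le_integral_norm _
    _ = _ := by simp only [hnorm _ _ (hf0 _) (hg0 _)]

theorem Lp_norm_rpow_eq_integral {α F : Type*} {mα : MeasurableSpace α} {μ : Measure α}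
    [NormedAddCommGroup F] {q : ℝ} (hq : 0 < q) (u : Lp F (ENNReal.ofReal q) μ) :
    ‖u‖ ^ q = ∫ x, ‖u x‖ ^ q ∂μ := by
  have htr : (ENNReal.ofReal q).toReal = q := ENNReal.toReal_ofReal hq.le
  have hI : 0 ≤ ∫ x, ‖u x‖ ^ q ∂μ := integral_nonneg fun x => by positivity
  rw [Lp.norm_def, toReal_eLpNorm (Lp.aestronglyMeasurable u),
    lpNorm_eq_integral_norm_rpow_toReal (by simpa using hq) ENNReal.ofReal_ne_top
      (Lp.aestronglyMeasurable u), htr, ← Real.rpow_mul hI, inv_mul_cancel₀ hq.ne', Real.rpow_one]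

theorem Lp_integrable_norm_rpow {α F : Type*} {mα : MeasurableSpace α} {μ : Measure α}
    [NormedAddCommGroup F] {q : ℝ} (hq : 0 < q) (u : Lp F (ENNReal.ofReal q) μ) :
    Integrable (fun x => ‖u x‖ ^ q) μ := by
  have h := (integrable_norm_rpow_iff (Lp.aestronglyMeasurable u) (by simpa using hq)
    ENNReal.ofReal_ne_top).2 (Lp.memLp u)
  rwa [ENNReal.toReal_ofReal hq.le] at h

theorem rpow_rpow_half_inv {a q : ℝ} (ha : 0 ≤ a) (hq : 0 < q) :
    (a ^ q) ^ (q / 2)⁻¹ = a ^ 2 := by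
  rw [← Real.rpow_mul ha, show q * (q / 2)⁻¹ = ((2 : ℕ) : ℝ) by push_cast; field_simp,
    Real.rpow_natCast]

/-- Three inequalities are chained: the triangle inequality in `ℓ^(p/q)` (needs `q ≤ p`) brings both
norms under one integral, the hypothesis on `F` applies pointwise, and Minkowski in `L^(q/2)` (needs
`q ≥ 2`) separates `u` from `v`. Vector values `F` and the case `q = p` allow a second use over `Ω`.
-/
theorem TwoPointSmooth.lpSpace {α F : Type*} {mα : MeasurableSpace α} (μ : Measure α)
    [NormedAddCommGroup F] {p q : ℝ} (hF : TwoPointSmooth p F) (hq : 2 ≤ q) (hqp : q ≤ p)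
    [Fact (1 ≤ ENNReal.ofReal q)] : TwoPointSmooth p (Lp F (ENNReal.ofReal q) μ) := by
  intro u v
  have hq0 : 0 < q := by linarith
  have hp0 : 0 < p := by linarith
  have hp1 : 0 ≤ p - 1 := by linarith
  have hr : 1 ≤ p / q := (one_le_div hq0).2 hqp
  have hr0 : 0 < p / q := by positivity
  have hs : 1 ≤ q / 2 := by linarith
  have hqr : ∀ a : ℝ, 0 ≤ a → (a ^ q) ^ (p / q) = a ^ p := by
    intro a ha
    rw [← Real.rpow_mul ha]; congr 1; field_simp
  have hA := integral_rpow_add_integral_rpow_le hr (fun x => by positivity)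
    (fun x => by positivity) (Lp_integrable_norm_rpow hq0 (u + v))
    (Lp_integrable_norm_rpow hq0 (u - v))
  rw [← Lp_norm_rpow_eq_integral hq0, ← Lp_norm_rpow_eq_integral hq0, hqr _ (norm_nonneg _),
    hqr _ (norm_nonneg _)] at hA
  simp only [hqr _ (norm_nonneg _)] at hA
  have hc : ∀ x, ((p - 1) * ‖v x‖ ^ 2) ^ (q / 2) = (p - 1) ^ (q / 2) * ‖v x‖ ^ q := fun x => by
    rw [Real.mul_rpow hp1 (by positivity), sq_rpow_half (norm_nonneg _)]
  have hmu := (Lp.aestronglyMeasurable u).norm.pow 2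
  have hmv := ((Lp.aestronglyMeasurable v).norm.pow 2).const_mul (p - 1)
  obtain ⟨hint, hB⟩ := integral_add_rpow_le (f := fun x => ‖u x‖ ^ 2)
    (g := fun x => (p - 1) * ‖v x‖ ^ 2) hs (fun x => by positivity) (fun x => by positivity)
    hmu hmv (by simpa only [sq_rpow_half (norm_nonneg _)] using Lp_integrable_norm_rpow hq0 u)
    (by simpa only [hc] using (Lp_integrable_norm_rpow hq0 v).const_mul _)
  simp only [hc, sq_rpow_half (norm_nonneg _), integral_const_mul] at hB
  rw [← Lp_norm_rpow_eq_integral hq0, ← Lp_norm_rpow_eq_integral hq0,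
    Real.mul_rpow (by positivity) (by positivity), rpow_rpow_half_inv (norm_nonneg _) hq0,
    rpow_rpow_half_inv (norm_nonneg _) hq0, ← Real.rpow_mul hp1,
    mul_inv_cancel₀ (by positivity), Real.rpow_one] at hB
  have hqp' : ∀ a : ℝ, 0 ≤ a → (a ^ (p / 2)) ^ (1 / (p / q)) = a ^ (q / 2) := by
    intro a ha
    rw [← Real.rpow_mul ha]; congr 1; field_simp
  have hC : ∫ x, (‖(u + v : Lp F _ μ) x‖ ^ p + ‖(u - v : Lp F _ μ) x‖ ^ p) ^ (1 / (p / q)) ∂μ ≤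
      ∫ x, 2 ^ (1 / (p / q)) * (‖u x‖ ^ 2 + (p - 1) * ‖v x‖ ^ 2) ^ (q / 2) ∂μ := by
    refine integral_mono_of_nonneg (Filter.Eventually.of_forall fun x => by positivity)
      (hint.const_mul _) ?_
    filter_upwards [Lp.coeFn_add u v, Lp.coeFn_sub u v] with x h1 h2
    rw [h1, h2, Pi.add_apply, Pi.sub_apply]
    have := Real.rpow_le_rpow (by positivity) (hF (u x) (v x))
      (show 0 ≤ 1 / (p / q) by positivity)
    rwa [Real.mul_rpow (by norm_num) (by positivity), hqp' _ (by positivity)] at this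
  rw [integral_const_mul] at hC
  have hD := hA.trans (hC.trans (mul_le_mul_of_nonneg_left hB (by positivity)))
  rw [← hqp' _ (by positivity), ← Real.mul_rpow (by norm_num) (by positivity)] at hD
  exact (Real.rpow_le_rpow_iff (by positivity) (by positivity) (by positivity)).1 hD

/-! ### 2-smoothness and Birkhoff orthogonality -/

/-- The quadratic mean is at most the `p`-th power mean, by convexity of `s ↦ s ^ (p / 2)`. -/
theorem TwoPointSmooth.sq_add_sq_le {E : Type*} [NormedAddCommGroup E] {p : ℝ} (hp : 2 ≤ p)
    (hE : TwoPointSmooth p E) (x y : E) :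
    ‖x + y‖ ^ 2 + ‖x - y‖ ^ 2 ≤ 2 * ‖x‖ ^ 2 + 2 * ((p - 1) * ‖y‖ ^ 2) := by
  have hp1 : 0 ≤ p - 1 := by linarith
  have key := (convexOn_rpow (show 1 ≤ p / 2 by linarith)).2
    (Set.mem_Ici.2 (sq_nonneg ‖x + y‖)) (Set.mem_Ici.2 (sq_nonneg ‖x - y‖))
    (by norm_num : (0 : ℝ) ≤ 1 / 2) (by norm_num : (0 : ℝ) ≤ 1 / 2) (by norm_num)
  simp only [smul_eq_mul, sq_rpow_half (norm_nonneg _)] at key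
  have h := (Real.rpow_le_rpow_iff (by positivity) (by positivity)
    (show 0 < p / 2 by linarith)).1 (key.trans (by linarith [hE x y] :
      _ ≤ (‖x‖ ^ 2 + (p - 1) * ‖y‖ ^ 2) ^ (p / 2)))
  linarith

/-- In a 2-smooth space, if `x` is orthogonal to `y` in the sense of Birkhoff, then the squared
norm of `x + y` exceeds that of `x` by at most `K ‖y‖²`. -/
theorem sq_norm_add_le_of_smooth {E : Type*} [NormedAddCommGroup E] [NormedSpace ℝ E] {K : ℝ}
    (hE : ∀ x y : E, ‖x + y‖ ^ 2 + ‖x - y‖ ^ 2 ≤ 2 * ‖x‖ ^ 2 + 2 * (K * ‖y‖ ^ 2)) {x y : E}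
    (hxy : ∀ t : ℝ, ‖x‖ ≤ ‖x + t • y‖) : ‖x + y‖ ^ 2 ≤ ‖x‖ ^ 2 + K * ‖y‖ ^ 2 := by
  -- Subtracting the quadratic makes `ψ` midpoint concave, so its increments over steps of length
  -- `s` decrease. Orthogonality bounds the increment from `-s` to `0` by `K ‖y‖² s²`; summing `N +
  -- 1` increments with `s = 1 / (N + 1)` leaves an error `K ‖y‖² s`, which tends to `0`.
  let ψ : ℝ → ℝ := fun t => ‖x + t • y‖ ^ 2 - K * ‖y‖ ^ 2 * t ^ 2
  have hψ : ∀ t s : ℝ, ψ (t + s) + ψ (t - s) ≤ 2 * ψ t := by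
    intro t s
    have h := hE (x + t • y) (s • y)
    rw [norm_smul, mul_pow, Real.norm_eq_abs, sq_abs] at h
    simp only [ψ, add_smul, sub_smul, ← add_assoc, ← add_sub_assoc]
    linarith
  have hψ0 : ψ 0 = ‖x‖ ^ 2 := by simp [ψ]
  have hbound : ∀ N : ℕ, ψ 1 ≤ ψ 0 + K * ‖y‖ ^ 2 * ((N : ℝ) + 1)⁻¹ := by
    intro N
    set s : ℝ := ((N : ℝ) + 1)⁻¹ with hs
    have hN : ((N : ℝ) + 1) * s = 1 := mul_inv_cancel₀ (by positivity)
    have hstep : ∀ k : ℕ, ψ (k * s) - ψ (k * s - s) ≤ K * ‖y‖ ^ 2 * s ^ 2 := by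
      intro k
      induction k with
      | zero =>
        have h2 : ‖x‖ ^ 2 ≤ ‖x + (-s) • y‖ ^ 2 := pow_le_pow_left₀ (norm_nonneg _) (hxy _) 2
        simp only [Nat.cast_zero, zero_mul, zero_sub, hψ0]
        simp only [ψ, neg_sq]
        linarith
      | succ k ih =>
        have h := hψ (k * s) s
        push_cast
        rw [show ((k : ℝ) + 1) * s = k * s + s by ring, add_sub_cancel_right]
        linarith
    have hsum : ∀ k : ℕ, ψ (k * s) ≤ ψ 0 + k * (K * ‖y‖ ^ 2 * s ^ 2) := by
      intro k
      induction k with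
      | zero => simp
      | succ k ih =>
        have h := hstep (k + 1)
        rw [show ((k + 1 : ℕ) : ℝ) * s - s = k * s by push_cast; ring] at h
        push_cast at h ⊢
        linarith
    have h := hsum (N + 1)
    push_cast at h
    rw [hN] at h
    calc ψ 1 ≤ _ := h
      _ = ψ 0 + K * ‖y‖ ^ 2 * s * (((N : ℝ) + 1) * s) := by ring
      _ = _ := by rw [hN, mul_one]
  have hlim : Filter.Tendsto (fun N : ℕ => ψ 0 + K * ‖y‖ ^ 2 * ((N : ℝ) + 1)⁻¹) Filter.atTop
      (nhds (ψ 0 + K * ‖y‖ ^ 2 * 0)) := by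
    have := tendsto_one_div_add_atTop_nhds_zero_nat (𝕜 := ℝ)
    simp only [one_div] at this
    exact (this.const_mul _).const_add _
  have h := ge_of_tendsto' hlim hbound
  rw [mul_zero, add_zero, hψ0] at h
  simp only [ψ, one_smul] at h
  linarith

/-! ### Moments of the martingale and the maximal inequality -/

theorem partialSum_zero {Ω E : Type*} [AddCommMonoid E] (d : ℕ → Ω → E) : partialSum d 0 = 0 := by
  ext ω; simp [partialSum]

theorem partialSum_succ {Ω E : Type*} [AddCommMonoid E] (d : ℕ → Ω → E) (k : ℕ) :
    partialSum d (k + 1) = partialSum d k + d (k + 1) := by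
  ext ω; simp [partialSum, Finset.sum_Icc_succ_top]

theorem toReal_eLpNorm_le_of_bound {Ω E : Type*} {mΩ : MeasurableSpace Ω}
    [NormedAddCommGroup E] {P : Measure Ω} [IsProbabilityMeasure P] {b : ℝ} (hb : 0 ≤ b)
    {f : Ω → E} (hf : ∀ᵐ ω ∂P, ‖f ω‖ ≤ b)
    (p : ENNReal) : (eLpNorm f p P).toReal ≤ b := by
  refine ENNReal.toReal_le_of_le_ofReal hb ?_
  simpa using eLpNorm_le_of_ae_bound (p := p) hf

section Martingale

variable {Ω E : Type*} {mΩ : MeasurableSpace Ω} [NormedAddCommGroup E] [NormedSpace ℝ E]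
  [CompleteSpace E] {P : Measure Ω} {ℱ : Filtration ℕ mΩ} {d : ℕ → Ω → E}

theorem IsMartingaleDifference.stronglyMeasurable_partialSum
    (hd : IsMartingaleDifference d ℱ P) (k : ℕ) : StronglyMeasurable[ℱ k] (partialSum d k) := by
  induction k with
  | zero => rw [partialSum_zero]; exact stronglyMeasurable_zero
  | succ k ih =>
    rw [partialSum_succ]
    exact (ih.mono (ℱ.mono k.le_succ)).add (hd.stronglyMeasurable _ (by omega))

variable [IsProbabilityMeasure P]

/-- Adding a bounded increment of zero conditional mean in a 2-smooth space. -/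
theorem sq_eLpNorm_add_le {p b : ℝ} (hp : 2 ≤ p) (hE : TwoPointSmooth p E)
    {m : MeasurableSpace Ω} (hm : m ≤ mΩ) {X D : Ω → E} (hXm : StronglyMeasurable[m] X)
    (hX : MemLp X (ENNReal.ofReal p) P) (hD : MemLp D (ENNReal.ofReal p) P)
    (hD0 : P[D | m] =ᵐ[P] 0) (hDb : (eLpNorm D (ENNReal.ofReal p) P).toReal ≤ b) :
    (eLpNorm (X + D) (ENNReal.ofReal p) P).toReal ^ 2 ≤
      (eLpNorm X (ENNReal.ofReal p) P).toReal ^ 2 + (p - 1) * b ^ 2 := by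
  have h1p : 1 ≤ ENNReal.ofReal p := by
    simpa using ENNReal.ofReal_le_ofReal (show 1 ≤ p by linarith)
  have : Fact (1 ≤ ENNReal.ofReal p) := ⟨h1p⟩
  -- Smoothness of `L^p(Ω; E)`, with the same exponent `p` inside and outside.
  have hsm := (hE.lpSpace P hp le_rfl).sq_add_sq_le hp
  have hXi : Integrable X P := hX.integrable h1p
  have hDi : Integrable D P := hD.integrable h1p
  have key := sq_norm_add_le_of_smooth hsm (x := hX.toLp X) (y := hD.toLp D) (by
    intro t
    rw [← MemLp.toLp_const_smul, ← MemLp.toLp_add, Lp.norm_toLp, Lp.norm_toLp]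
    refine ENNReal.toReal_mono (hX.add (hD.const_smul t)).eLpNorm_ne_top ?_
    -- Birkhoff orthogonality: `X` is the conditional expectation of `X + t D`, and conditional
    -- expectation is an `L^p` contraction.
    refine le_trans (eLpNorm_congr_ae ?_).le (eLpNorm_condExp_le_eLpNorm (m := m) _ h1p)
    filter_upwards [condExp_add hXi (hDi.smul t) m, condExp_smul (μ := P) t D m, hD0]
      with ω h1 h2 h3
    rw [h1, Pi.add_apply, h2, condExp_of_stronglyMeasurable hm hXm hXi, Pi.smul_apply, h3]
    simp)
  rw [← MemLp.toLp_add, Lp.norm_toLp, Lp.norm_toLp, Lp.norm_toLp] at key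
  have := mul_le_mul_of_nonneg_left (pow_le_pow_left₀ ENNReal.toReal_nonneg hDb 2)
    (show 0 ≤ p - 1 by linarith)
  linarith

theorem IsMartingaleDifference.memLp {b : ℝ} (hd : IsMartingaleDifference d ℱ P)
    (hdb : ∀ i, 1 ≤ i → ∀ᵐ ω ∂P, ‖d i ω‖ ≤ b) (p : ENNReal) {i : ℕ} (hi : 1 ≤ i) :
    MemLp (d i) p P :=
  MemLp.of_bound (hd.integrable i hi).aestronglyMeasurable b (hdb i hi)

theorem IsMartingaleDifference.memLp_partialSum {b : ℝ} (hd : IsMartingaleDifference d ℱ P)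
    (hdb : ∀ i, 1 ≤ i → ∀ᵐ ω ∂P, ‖d i ω‖ ≤ b) (p : ENNReal) (k : ℕ) :
    MemLp (partialSum d k) p P := by
  induction k with
  | zero => rw [partialSum_zero]; exact MemLp.zero
  | succ k ih => rw [partialSum_succ]; exact ih.add (hd.memLp hdb p (by omega))

theorem IsMartingaleDifference.sq_eLpNorm_partialSum_le {p b : ℝ} (hp : 2 ≤ p)
    (hE : TwoPointSmooth p E) (hd : IsMartingaleDifference d ℱ P) (hb : 0 ≤ b)
    (hdb : ∀ i, 1 ≤ i → ∀ᵐ ω ∂P, ‖d i ω‖ ≤ b) (k : ℕ) :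
    (eLpNorm (partialSum d k) (ENNReal.ofReal p) P).toReal ^ 2 ≤ b ^ 2 * (p - 1) * k := by
  induction k with
  | zero => simp [partialSum_zero]
  | succ k ih =>
    have hN := toReal_eLpNorm_le_of_bound hb (hdb (k + 1) (by omega)) (ENNReal.ofReal p)
    -- `d 1` is not assumed centred; for it, the plain bound `b² ≤ (p - 1) b²` suffices.
    rcases Nat.eq_zero_or_pos k with rfl | hk
    · rw [partialSum_succ, partialSum_zero, zero_add]
      have := pow_le_pow_left₀ ENNReal.toReal_nonneg hN 2
      norm_num at this ⊢
      nlinarith [sq_nonneg b]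
    · rw [partialSum_succ]
      have := sq_eLpNorm_add_le hp hE (ℱ.le k) (hd.stronglyMeasurable_partialSum k)
        (hd.memLp_partialSum hdb _ k) (hd.memLp hdb _ (by omega)) (hd.condExp_eq_zero k hk) hN
      push_cast
      linarith

theorem IsMartingaleDifference.integral_norm_partialSum_rpow_le {p b : ℝ} (hp : 2 ≤ p)
    (hE : TwoPointSmooth p E) (hd : IsMartingaleDifference d ℱ P) (hb : 0 ≤ b)
    (hdb : ∀ i, 1 ≤ i → ∀ᵐ ω ∂P, ‖d i ω‖ ≤ b) (k : ℕ) :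
    ∫ ω, ‖partialSum d k ω‖ ^ p ∂P ≤ (b ^ 2 * (p - 1) * k) ^ (p / 2) := by
  have hp0 : 0 < p := by linarith
  have hM := hd.memLp_partialSum hdb (ENNReal.ofReal p) k
  have h := hd.sq_eLpNorm_partialSum_le hp hE hb hdb k
  have hI : 0 ≤ ∫ ω, ‖partialSum d k ω‖ ^ p ∂P := integral_nonneg fun _ => by positivity
  rw [toReal_eLpNorm hM.1, lpNorm_eq_integral_norm_rpow_toReal (by simpa using hp0)
    ENNReal.ofReal_ne_top hM.1, ENNReal.toReal_ofReal hp0.le] at h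
  have := Real.rpow_le_rpow (by positivity) h (show 0 ≤ p / 2 by positivity)
  rwa [sq_rpow_half (by positivity), ← Real.rpow_mul hI, inv_mul_cancel₀ hp0.ne',
    Real.rpow_one] at this

theorem IsMartingaleDifference.integrable_norm_partialSum_rpow {p b : ℝ} (hp : 0 < p)
    (hd : IsMartingaleDifference d ℱ P)
    (hdb : ∀ i, 1 ≤ i → ∀ᵐ ω ∂P, ‖d i ω‖ ≤ b) (k : ℕ) :
    Integrable (fun ω => ‖partialSum d k ω‖ ^ p) P := by
  have hM := hd.memLp_partialSum hdb (ENNReal.ofReal p) k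
  have h := (integrable_norm_rpow_iff hM.1 (by simpa using hp) ENNReal.ofReal_ne_top).2 hM
  rwa [ENNReal.toReal_ofReal hp.le] at h

/-- Conditional Jensen for `‖·‖ ^ p`; the step from `0` to `1` uses only `M_0 = 0`, as `d 1` need
not be centred. -/
theorem IsMartingaleDifference.submartingale_norm_partialSum_rpow {p b : ℝ} (hp : 1 ≤ p)
    (hd : IsMartingaleDifference d ℱ P) (hdb : ∀ i, 1 ≤ i → ∀ᵐ ω ∂P, ‖d i ω‖ ≤ b) :
    Submartingale (fun k ω => ‖partialSum d k ω‖ ^ p) ℱ P := by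
  have hp0 : 0 < p := by linarith
  refine submartingale_nat (fun k => ?_) (hd.integrable_norm_partialSum_rpow hp0 hdb) fun k => ?_
  · exact (Real.continuous_rpow_const hp0.le).comp_stronglyMeasurable
      (hd.stronglyMeasurable_partialSum k).norm
  · rcases Nat.eq_zero_or_pos k with rfl | hk
    · have h0 : (fun ω => ‖partialSum d 0 ω‖ ^ p) = 0 := by
        ext ω; simp [partialSum_zero, Real.zero_rpow hp0.ne']
      rw [h0]
      exact condExp_nonneg (Filter.Eventually.of_forall fun ω => by
        simp only [Pi.zero_apply]; positivity)
    · have hMi : Integrable (partialSum d k) P :=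
        (hd.memLp_partialSum hdb 1 k).integrable le_rfl
      filter_upwards [Integrable.norm_condExp_rpow_le (m := ℱ k) hp
          (hd.integrable_norm_partialSum_rpow hp0 hdb (k + 1)),
        condExp_add hMi (hd.integrable (k + 1) (by omega)) (ℱ k), hd.condExp_eq_zero k hk]
        with ω h1 h2 h3
      rw [partialSum_succ, h2, Pi.add_apply, h3, condExp_of_stronglyMeasurable (ℱ.le k)
        (hd.stronglyMeasurable_partialSum k) hMi, Pi.zero_apply, add_zero] at h1
      rwa [partialSum_succ]

theorem IsMartingaleDifference.measureReal_max_norm_partialSum_le {p b : ℝ} (hp : 2 ≤ p)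
    (hE : TwoPointSmooth p E) (hd : IsMartingaleDifference d ℱ P) (hb : 0 ≤ b)
    (hdb : ∀ i, 1 ≤ i → ∀ᵐ ω ∂P, ‖d i ω‖ ≤ b) {n : ℕ} (hn : 1 ≤ n) {x : ℝ} (hx : 0 < x) :
    P.real {ω | x ≤ (Finset.Icc 1 n).sup' (Finset.nonempty_Icc.mpr hn)
      (fun k => ‖partialSum d k ω‖)} ≤ (b ^ 2 * (p - 1) * n) ^ (p / 2) / x ^ p := by
  have hp0 : 0 < p := by linarith
  have hxp : 0 < x ^ p := Real.rpow_pos_of_pos hx p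
  have hmax := maximal_ineq (hd.submartingale_norm_partialSum_rpow (p := p) (by linarith) hdb)
    (fun k ω => by simp only [Pi.zero_apply]; positivity) (ε := (x ^ p).toNNReal) n
  simp only [Real.coe_toNNReal _ hxp.le] at hmax
  set S := {ω | x ^ p ≤ (Finset.range (n + 1)).sup' Finset.nonempty_range_add_one
    fun k => ‖partialSum d k ω‖ ^ p} with hS
  have hle : ∫ ω in S, ‖partialSum d n ω‖ ^ p ∂P ≤ (b ^ 2 * (p - 1) * n) ^ (p / 2) :=
    (setIntegral_le_integral (hd.integrable_norm_partialSum_rpow hp0 hdb n)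
      (Filter.Eventually.of_forall fun ω => by simp only [Pi.zero_apply]; positivity)).trans
      (hd.integral_norm_partialSum_rpow_le hp hE hb hdb n)
  have hI : 0 ≤ ∫ ω in S, ‖partialSum d n ω‖ ^ p ∂P := integral_nonneg fun _ => by positivity
  have h := ENNReal.toReal_mono ENNReal.ofReal_ne_top hmax
  rw [ENNReal.toReal_mul, ENNReal.toReal_ofReal hI, ENNReal.coe_toReal,
    Real.coe_toNNReal _ hxp.le] at h
  have hsub : {ω | x ≤ (Finset.Icc 1 n).sup' (Finset.nonempty_Icc.mpr hn)
      (fun k => ‖partialSum d k ω‖)} ⊆ S := by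
    intro ω hω
    rw [Set.mem_ofPred_eq, Finset.le_sup'_iff] at hω
    obtain ⟨k, hk, hxk⟩ := hω
    rw [hS, Set.mem_ofPred_eq, Finset.le_sup'_iff]
    exact ⟨k, Finset.mem_range.2 (by have := Finset.mem_Icc.1 hk; omega),
      Real.rpow_le_rpow hx.le hxk hp0.le⟩
  rw [le_div_iff₀ hxp, mul_comm]
  refine (mul_le_mul_of_nonneg_left (measureReal_mono hsub) hxp.le).trans ?_
  exact le_trans h hle

end Martingale

/-! ### Choice of the exponent and comparison with Pinelis' bound -/

/-- The choice `p = 1 + x² / (e b² n)` of the exponent in the moment bound. -/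
theorem moment_bound_eq_exp {b x : ℝ} {n : ℕ} (hb : 0 < b) (hn : 1 ≤ n) (hx : 0 < x) {p : ℝ}
    (hp : p = 1 + x ^ 2 / (Real.exp 1 * b ^ 2 * n)) :
    (b ^ 2 * (p - 1) * n) ^ (p / 2) / x ^ p =
      1 / √(Real.exp 1) * Real.exp (-(x ^ 2 / (2 * Real.exp 1 * b ^ 2 * n))) := by
  have hn0 : (0 : ℝ) < n := by exact_mod_cast hn
  have he := Real.exp_pos 1
  have h1 : b ^ 2 * (p - 1) * n = x ^ 2 / Real.exp 1 := by
    rw [hp]; field_simp; ring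
  rw [h1, Real.div_rpow (by positivity) he.le, sq_rpow_half hx.le, div_right_comm,
    div_self (Real.rpow_pos_of_pos hx p).ne', ← Real.exp_mul, one_mul, one_div, ← Real.exp_neg,
    Real.sqrt_eq_rpow, ← Real.exp_mul, one_div, ← Real.exp_neg, ← Real.exp_add, hp]
  congr 1
  field_simp
  ring

theorem mul_sqrt_le_iff {b c x : ℝ} (hb : 0 < b) (hc : 0 ≤ c) (hx : 0 < x) :
    b * √c ≤ x ↔ b ^ 2 * c ≤ x ^ 2 := by
  rw [← pow_le_pow_iff_left₀ (by positivity) hx.le two_ne_zero, mul_pow, Real.sq_sqrt hc]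

/-- In the variable `u = x² / ((q - 1) b² n)` Pinelis' bound is `2 exp (-u / 2)`, and the regimes
are `u < 1`, `1 ≤ u < e` and `u ≥ e`. -/
theorem threeRegimeBound_lt_pinelisBound {q b x : ℝ} {n : ℕ} (hq : Real.exp 1 + 1 ≤ q)
    (hb : 0 < b) (hn : 1 ≤ n) (hx : 0 < x) : threeRegimeBound q b n x < pinelisBound q b n x := by
  have hn0 : (0 : ℝ) < n := by exact_mod_cast hn
  have he := Real.exp_pos 1
  have he2 : (2 : ℝ) < Real.exp 1 := by linarith [Real.exp_one_gt_d9]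
  have he3 : Real.exp 1 < 3 := by linarith [Real.exp_one_lt_d9]
  have hq1 : 0 < q - 1 := by linarith
  have hhalf : 1 < 2 * Real.exp (-(1 / 2)) := by
    have := Real.add_one_lt_exp (show (-(1 / 2) : ℝ) ≠ 0 by norm_num)
    linarith
  set u := x ^ 2 / ((q - 1) * b ^ 2 * n) with hu
  have hu0 : 0 < u := by positivity
  have hxu : x ^ 2 = u * (b ^ 2 * (q - 1) * n) := by rw [hu]; field_simp
  have hpin : pinelisBound q b n x = 2 * Real.exp (-(u / 2)) := by
    rw [pinelisBound, hu]; congr 3; field_simp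
  have hA : 0 < b ^ 2 * (q - 1) * n := by positivity
  rw [hpin, threeRegimeBound]
  split_ifs with h1 h2
  · have hu1 : u < 1 := by
      rw [← not_le, mul_sqrt_le_iff hb (by positivity) hx, not_le, hxu] at h1
      by_contra! h
      nlinarith
    have : Real.exp (-(1 / 2)) < Real.exp (-(u / 2)) := Real.exp_lt_exp.2 (by linarith)
    linarith
  · have hu1 : 1 ≤ u := by
      rw [not_lt, mul_sqrt_le_iff hb (by positivity) hx, hxu] at h1
      by_contra! h
      nlinarith
    have hu3 : u < 3 := by
      rw [← not_le, mul_sqrt_le_iff hb (by positivity) hx, not_le, hxu] at h2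
      by_contra! h
      nlinarith
    rw [← sq_rpow_half hx.le q, ← Real.div_rpow (by positivity) (by positivity), hxu,
      show b ^ 2 * (q - 1) * n / (u * (b ^ 2 * (q - 1) * n)) = u⁻¹ by field_simp,
      Real.rpow_def_of_pos (by positivity), Real.log_inv]
    -- The aim is `u - 1 ≤ q log u`, which gives `u ^ (-q / 2) ≤ √e exp (-u / 2)` with `√e < 2`. It
    -- follows from `log u ≥ 1 - 1 / u`, `1 ≤ u < 3` and `q ≥ e + 1 > 3`.
    have hlog := Real.one_sub_inv_le_log_of_pos hu0
    have h3 : u - 1 ≤ 3 * (1 - u⁻¹) := by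
      have : 3 * (1 - u⁻¹) - (u - 1) = (u - 1) * (3 - u) / u := by field_simp
      have h4 : 0 ≤ (u - 1) * (3 - u) / u :=
        div_nonneg (mul_nonneg (by linarith) (by linarith)) hu0.le
      linarith
    have h5 : 3 * Real.log u ≤ q * Real.log u :=
      mul_le_mul_of_nonneg_right (by linarith) (Real.log_nonneg hu1)
    calc Real.exp (-Real.log u * (q / 2)) ≤ Real.exp (1 / 2 + -(u / 2)) :=
          Real.exp_le_exp.2 (by linarith)
      _ = Real.exp (1 / 2) * Real.exp (-(u / 2)) := Real.exp_add _ _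
      _ < 2 * Real.exp (-(u / 2)) := by
        refine mul_lt_mul_of_pos_right ?_ (Real.exp_pos _)
        have : Real.exp (1 / 2) * Real.exp (-(1 / 2)) = 1 := by rw [← Real.exp_add]; simp
        nlinarith [Real.exp_pos (-(1 / 2) : ℝ)]
  -- Here `q - 1 ≥ e` makes the exponent at least as good as Pinelis', and the prefactor is at most
  -- `1`.
  · have h3 : u ≤ x ^ 2 / (Real.exp 1 * b ^ 2 * n) := by
      rw [hu]
      gcongr
      linarith
    have h4 : x ^ 2 / (2 * Real.exp 1 * b ^ 2 * n) = x ^ 2 / (Real.exp 1 * b ^ 2 * n) / 2 := by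
      field_simp
    have h5 : 1 / √(Real.exp 1) ≤ 1 := by
      rw [div_le_one (by positivity)]
      exact Real.one_le_sqrt.2 (by linarith)
    have h6 : Real.exp (-(x ^ 2 / (2 * Real.exp 1 * b ^ 2 * n))) ≤ Real.exp (-(u / 2)) :=
      Real.exp_le_exp.2 (by linarith)
    have := mul_le_mul h5 h6 (Real.exp_pos _).le zero_le_one
    have := Real.exp_pos (-(u / 2))
    linarith

theorem mainTheorem4 {𝒳 Ω : Type*} [MeasurableSpace 𝒳] (μ : Measure 𝒳)
    (q : ℝ) [Fact (2 ≤ q)]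
    {mΩ : MeasurableSpace Ω} (P : Measure Ω) [IsProbabilityMeasure P]
    (ℱ : Filtration ℕ mΩ) (d : ℕ → Ω → Lp ℝ (ENNReal.ofReal q) μ)
    (hd : IsMartingaleDifference d ℱ P)
    (b : ℝ) (hb : 0 < b)
    (hdb : ∀ i, 1 ≤ i → eLpNorm (fun ω => ‖d i ω‖) ⊤ P ≤ ENNReal.ofReal b) :
    (∀ (n : ℕ) (hn : 1 ≤ n) (x : ℝ), 0 < x →
      P.real {ω | x ≤ (Finset.Icc 1 n).sup' (Finset.nonempty_Icc.mpr hn)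
        (fun k => ‖partialSum d k ω‖)} ≤ threeRegimeBound q b n x) ∧
    (Real.exp 1 + 1 ≤ q → ∀ (n : ℕ) (x : ℝ), 1 ≤ n → 0 < x →
      threeRegimeBound q b n x < pinelisBound q b n x) := by
  have hq : 2 ≤ q := Fact.out
  refine ⟨fun n hn x hx => ?_, fun hq n x hn hx => threeRegimeBound_lt_pinelisBound hq hb hn hx⟩
  have hdb' : ∀ i, 1 ≤ i → ∀ᵐ ω ∂P, ‖d i ω‖ ≤ b := by
    intro i hi
    have h := hdb i hi
    rw [eLpNorm_norm, eLpNorm_exponent_top] at h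
    filter_upwards [ae_le_eLpNormEssSup (f := d i) (μ := P)] with ω hω
    have := hω.trans h
    rwa [← ofReal_norm, ENNReal.ofReal_le_ofReal_iff hb.le] at this
  have hmain : ∀ p, q ≤ p → _ := fun p hqp =>
    hd.measureReal_max_norm_partialSum_le (hq.trans hqp)
      ((twoPointSmooth_real (hq.trans hqp)).lpSpace μ hq hqp) hb.le hdb' hn hx
  rw [threeRegimeBound]
  split_ifs with h1 h2
  · exact measureReal_le_one
  · exact hmain q le_rfl
  · have hn0 : (0 : ℝ) < n := by exact_mod_cast hn
    have he := Real.exp_pos 1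
    have hq1 : 0 < q - 1 := by linarith
    rw [not_lt, mul_sqrt_le_iff hb (by positivity) hx] at h2
    rw [← moment_bound_eq_exp hb hn hx rfl]
    -- What remains is `p ≥ q` for the chosen exponent, which is the condition defining the third
    -- regime.
    refine hmain _ ?_
    rw [← sub_le_iff_le_add', le_div_iff₀ (by positivity)]
    linarith
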